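/- Let $n$ be an odd positive integer, let $\mu$ be the Wiener measure on the $n$-dimensional Wiener space $C_0([0,1],\mathbb{R}^n)=\{w\in C([0,1],\mathbb{R}^n): w_0=0\}$ (with the $\sigma$-algebra generated by the coordinate maps), and let $W_t(w)=w_t$ be the coordinate process, so that under $\mu$ it is a standard $n$-dimensional Brownian motion. Let $\gamma:[0,1]\to O(n)$ be a (non-random) function with values in the real orthogonal $n\times n$ matrices whose entries are Lebesgue measurable, and let $T:C_0([0,1],\mathbb{R}^n)\to C_0([0,1],\mathbb{R}^n)$ be the transformation $Y=T(W)$ given by $dY_t=\gamma(t)\,dW_t$, $Y_0=0$; that is, $T$ is a measurable map such that, for every $t\in[0,1]$ and every $i$, $$(Tw)^i_t=\Big(\sum_{j=1}^n\int_0^t\gamma_{ij}(s)\,dW^j_s\Big)(w)\quad\text{for }\mu\text{-almost every }w,$$ where the integrals are Wiener integrals. Then $T$ preserves $\mu$ and is not ergodic with respect to $\mu$. -/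

import Mathlib

open MeasureTheory ProbabilityTheory
open scoped unitInterval ENNReal

noncomputable section

/-- The classical `n`-dimensional Wiener space `C₀([0,1], ℝⁿ)`: the continuous paths
`w : [0,1] → ℝⁿ` with `w 0 = 0`. -/
def WienerSpace (n : ℕ) : Type :=
  {w : C(I, EuclideanSpace ℝ (Fin n)) // w 0 = 0}

namespace WienerSpace

/-- A Wiener path, seen as a function of time. -/
instance instCoeFun (n : ℕ) : CoeFun (WienerSpace n) (fun _ => I → EuclideanSpace ℝ (Fin n)) :=
  ⟨fun w => ⇑w.1⟩

/-- The σ-algebra generated by the coordinate maps `w ↦ w t`, `t ∈ [0,1]`. It is also the Borel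
σ-algebra of the topology of uniform convergence. -/
instance instMeasurableSpace (n : ℕ) : MeasurableSpace (WienerSpace n) :=
  MeasurableSpace.comap (fun (w : WienerSpace n) (t : I) => w t) MeasurableSpace.pi

end WienerSpace

/-- `μ` is the Wiener measure on `C₀([0,1], ℝⁿ)`: under `μ`, the coordinate process
`W t w = w t` is a standard `n`-dimensional Brownian motion on `[0,1]`. That is, it has independent
increments, and for `s ≤ t` the increment `W t - W s` is a centered Gaussian vector with covariance
matrix `(t - s)` times the identity. (The paths are continuous and start at `0` by the choice of the
space.) These conditions determine `μ`, and they imply that it is a probability measure. -/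
structure IsWienerMeasure {n : ℕ} (μ : Measure (WienerSpace n)) : Prop where
  indep_increments : HasIndepIncrements (fun (t : I) (w : WienerSpace n) => w t) μ
  law_increment : ∀ s t : I, s ≤ t →
    HasLaw (fun w : WienerSpace n => w t - w s)
      (multivariateGaussian (0 : EuclideanSpace ℝ (Fin n))
        (((t : ℝ) - (s : ℝ)) • (1 : Matrix (Fin n) (Fin n) ℝ))) μ

/-- The step function `∑ i, c i • 1_{(a i, b i]}` on `[0,1]` with values in `ℝⁿ`. -/
def stepFunction {n m : ℕ} (a b : Fin m → I) (c : Fin m → EuclideanSpace ℝ (Fin n)) (s : I) :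
    EuclideanSpace ℝ (Fin n) :=
  ∑ i, (Set.Ioc (a i) (b i)).indicator (fun _ => c i) s

/-- The elementary integral `∑ i, ⟨c i, w (b i) - w (a i)⟩` of a step function against a path. -/
def stepIntegral {n m : ℕ} (a b : Fin m → I) (c : Fin m → EuclideanSpace ℝ (Fin n))
    (w : WienerSpace n) : ℝ :=
  ∑ i, inner ℝ (c i) (w (b i) - w (a i))

/-- `X` is (a version of) the Wiener integral `∫₀¹ ⟨g s, dW s⟩` of the deterministic integrand
`g : [0,1] → ℝⁿ`: it is the limit in `L²(μ)` of elementary integrals of step functions which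
converge to `g` in `L²([0,1], ℝⁿ)`. -/
def IsWienerIntegral {n : ℕ} (μ : Measure (WienerSpace n)) (g : I → EuclideanSpace ℝ (Fin n))
    (X : WienerSpace n → ℝ) : Prop :=
  AEStronglyMeasurable X μ ∧
  ∀ ε : ℝ≥0∞, 0 < ε → ∃ (m : ℕ) (a b : Fin m → I) (c : Fin m → EuclideanSpace ℝ (Fin n)),
    (∀ i, a i ≤ b i) ∧
    eLpNorm (fun s => stepFunction a b c s - g s) 2 volume < ε ∧
    eLpNorm (fun w => stepIntegral a b c w - X w) 2 μ < ε

/-- `T : C₀([0,1], ℝⁿ) → C₀([0,1], ℝⁿ)` is the transformation `Y = T(W)` given by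
`dY t = γ t dW t`, `Y 0 = 0`: it is a measurable map, and for every `t ∈ [0,1]` the `i`-th
component of `Y t` is, `μ`-almost surely, the Wiener integral `∑ j, ∫₀ᵗ γ i j dW j`, that is, the
Wiener integral of the `i`-th row of `γ`, cut off after time `t`. (`T` is determined up to
`μ`-almost sure equality.) -/
structure IsWienerTransformation {n : ℕ} (μ : Measure (WienerSpace n))
    (γ : I → Matrix (Fin n) (Fin n) ℝ) (T : WienerSpace n → WienerSpace n) : Prop where
  measurable : Measurable T
  integral : ∀ (t : I) (i : Fin n),
    IsWienerIntegral μ ((Set.Iic t).indicator fun s => WithLp.toLp 2 (γ s i))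
      (fun w => T w t i)

end

/-! The Wiener integral is an isometry from L²([0,1], ℝⁿ) to L²(μ), and T acts on it through the
integrand: if X is the integral of g, then X ∘ T is the integral of γᵀg (`map_mem_integralGraph`).
The isometry is handled through its graph, a closed subspace of the product of the two L² spaces.

Each integral is a centered Gaussian whose variance is the squared norm of its integrand. Pointwise
multiplication by γᵀ keeps that norm, so W and T(W) have the same finite-dimensional laws and T
preserves μ.

Since n is odd, each γ(s)ᵀ has an eigenvalue ε = ±1. Suppose T is ergodic. The mean ergodic theorem
for εγᵀ on integrands and for X ↦ εX ∘ T on variables yields a limit pair (g, X) in the graph with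
εX ∘ T = X. Then |X| is invariant, hence constant, and a Gaussian X of constant modulus forces g =
0. Pointwise, however, the averages of a vector c under εγ(s)ᵀ tend to its projection onto the fixed
space. That space is therefore zero for almost every s and both signs, which contradicts the
eigenvalue. Averaging constant vectors avoids a measurable choice of eigenvectors. -/

namespace WienerSpace

variable {n : ℕ}

lemma measurable_coe : Measurable (fun (w : WienerSpace n) (t : I) => w t) :=
  comap_measurable _

@[simp]
lemma eval_zero (w : WienerSpace n) : w 0 = 0 := w.2

/-- Measures on the Wiener space which give the coordinate process the same law are equal. -/
lemma measure_ext_of_map_coe {μ ν : Measure (WienerSpace n)}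
    (h : μ.map (fun w (t : I) => w t) = ν.map (fun w (t : I) => w t)) : μ = ν := by
  ext s hs
  obtain ⟨B, hB, rfl⟩ := hs
  rw [← Measure.map_apply measurable_coe hB, h, Measure.map_apply measurable_coe hB]

end WienerSpace

/-! ### Brownian moments and covariances. -/

namespace IsWienerMeasure

variable {n : ℕ} {μ : Measure (WienerSpace n)}

lemma posSemidef_smul_one {r : ℝ} (hr : 0 ≤ r) :
    (r • (1 : Matrix (Fin n) (Fin n) ℝ)).PosSemidef :=
  Matrix.PosSemidef.one.smul hr

lemma hasLaw_eval (hμ : IsWienerMeasure μ) (t : I) :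
    HasLaw (fun w : WienerSpace n => w t)
      (multivariateGaussian 0 ((t : ℝ) • (1 : Matrix (Fin n) (Fin n) ℝ))) μ := by
  simpa using hμ.law_increment 0 t t.2.1

lemma isProbabilityMeasure (hμ : IsWienerMeasure μ) : IsProbabilityMeasure μ :=
  (hμ.hasLaw_eval 0).hasGaussianLaw.isProbabilityMeasure

lemma isGaussianProcess (hμ : IsWienerMeasure μ) :
    IsGaussianProcess (fun (t : I) (w : WienerSpace n) => w t) μ :=
  hμ.indep_increments.isGaussianProcess (fun t => (hμ.hasLaw_eval t).hasGaussianLaw)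
    (.of_forall fun w => w.2)

lemma memLp_inner_eval (hμ : IsWienerMeasure μ) (t : I) (c : EuclideanSpace ℝ (Fin n)) :
    MemLp (fun w : WienerSpace n => inner ℝ c (w t)) 2 μ :=
  ((hμ.hasLaw_eval t).hasGaussianLaw.map_fun (innerSL ℝ c)).memLp_two

lemma integral_inner_eval (hμ : IsWienerMeasure μ) (t : I) (c : EuclideanSpace ℝ (Fin n)) :
    ∫ w : WienerSpace n, inner ℝ c (w t) ∂μ = 0 := by
  have h := (innerSL ℝ c).integral_comp_comm (hμ.hasLaw_eval t).hasGaussianLaw.integrable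
  simp only [innerSL_apply_apply] at h
  rw [h, (hμ.hasLaw_eval t).integral_eq, integral_id_multivariateGaussian, inner_zero_right]

lemma covariance_inner_eval_self (hμ : IsWienerMeasure μ) (t : I)
    (c d : EuclideanSpace ℝ (Fin n)) :
    cov[fun w : WienerSpace n => inner ℝ c (w t), fun w => inner ℝ d (w t); μ]
      = t * inner ℝ c d := by
  rw [(hμ.hasLaw_eval t).covariance_fun_comp (f := fun x => inner ℝ c x)
    (g := fun x => inner ℝ d x) (by fun_prop) (by fun_prop),
    ← covarianceBilin_apply_eq_cov IsGaussian.memLp_two_id,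
    covarianceBilin_multivariateGaussian (posSemidef_smul_one t.2.1), Matrix.smul_mulVec,
    Matrix.one_mulVec, dotProduct_smul, smul_eq_mul, EuclideanSpace.inner_eq_star_dotProduct,
    dotProduct_comm]
  simp

lemma covariance_inner_eval_of_le (hμ : IsWienerMeasure μ) {s t : I} (hst : s ≤ t)
    (c d : EuclideanSpace ℝ (Fin n)) :
    cov[fun w : WienerSpace n => inner ℝ c (w s), fun w => inner ℝ d (w t); μ]
      = s * inner ℝ c d := by
  have := hμ.isProbabilityMeasure
  have hind : IndepFun (fun w : WienerSpace n => inner ℝ c (w s))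
      (fun w => inner ℝ d (w t - w s)) μ :=
    (hμ.indep_increments.indepFun_eval_sub s.2.1 hst (.of_forall fun w => w.2)).comp
      (φ := fun x => inner ℝ c x) (ψ := fun x => inner ℝ d x) (by fun_prop) (by fun_prop)
  have hd : (fun w : WienerSpace n => inner ℝ d (w t)) =
      (fun w : WienerSpace n => inner ℝ d (w s)) + fun w => inner ℝ d (w t - w s) := by
    ext w; simp [inner_sub_right]
  have hm : MemLp (fun w : WienerSpace n => inner ℝ d (w t - w s)) 2 μ := by
    simpa only [inner_sub_right] using!
      (hμ.memLp_inner_eval t d).sub (hμ.memLp_inner_eval s d)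
  rw [hd, covariance_add_right (hμ.memLp_inner_eval s c) (hμ.memLp_inner_eval s d) hm,
    hμ.covariance_inner_eval_self,
    hind.covariance_eq_zero (hμ.memLp_inner_eval s c) hm, add_zero]

lemma integral_inner_eval_mul_inner_eval (hμ : IsWienerMeasure μ) (s t : I)
    (c d : EuclideanSpace ℝ (Fin n)) :
    ∫ w : WienerSpace n, inner ℝ c (w s) * inner ℝ d (w t) ∂μ
      = (min s t : I) * inner ℝ c d := by
  have := hμ.isProbabilityMeasure
  have key := covariance_eq_sub (hμ.memLp_inner_eval s c) (hμ.memLp_inner_eval t d)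
  rw [hμ.integral_inner_eval, zero_mul, sub_zero] at key
  refine key.symm.trans ?_
  rcases le_total s t with h | h
  · rw [hμ.covariance_inner_eval_of_le h, min_eq_left h]
  · rw [covariance_comm, hμ.covariance_inner_eval_of_le h, min_eq_right h, real_inner_comm]

end IsWienerMeasure

/-- On a probability space, `X ↦ E[exp(iX)]` is continuous on `L²`. -/
lemma continuous_integral_cexp_Lp {Ω : Type*} {mΩ : MeasurableSpace Ω} (P : Measure Ω)
    [IsProbabilityMeasure P] :
    Continuous fun X : Lp ℝ 2 P => ∫ ω, Complex.exp (X ω * Complex.I) ∂P := by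
  have hint (X : Lp ℝ 2 P) : Integrable (fun ω => Complex.exp (X ω * Complex.I)) P := by
    refine (integrable_const (1 : ℝ)).mono ?_ (.of_forall fun ω => ?_)
    · have := (Lp.aestronglyMeasurable X)
      fun_prop
    · simp [Complex.norm_exp_ofReal_mul_I]
  -- The bound is |e^{ix} - e^{iy}| ≤ |x - y|, followed by ‖·‖₁ ≤ ‖·‖₂ on a probability space.
  refine LipschitzWith.continuous (K := 1) (LipschitzWith.of_dist_le_mul fun X Y => ?_)
  rw [dist_eq_norm, ← integral_sub (hint X) (hint Y), NNReal.coe_one, one_mul, dist_eq_norm]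
  have hXY : Integrable (X - Y : Lp ℝ 2 P) P :=
    (Lp.memLp (X - Y)).integrable (by norm_num)
  calc ‖∫ ω, (Complex.exp (X ω * Complex.I) - Complex.exp (Y ω * Complex.I)) ∂P‖
      ≤ ∫ ω, ‖(X - Y : Lp ℝ 2 P) ω‖ ∂P := by
        refine norm_integral_le_of_norm_le hXY.norm ?_
        filter_upwards [Lp.coeFn_sub X Y] with ω hω
        have h : Complex.exp (X ω * Complex.I) - Complex.exp (Y ω * Complex.I) =
            Complex.exp (Y ω * Complex.I) *
              (Complex.exp (Complex.I * (X ω - Y ω : ℝ)) - 1) := by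
          rw [mul_sub, ← Complex.exp_add]
          push_cast
          ring_nf
        rw [h, norm_mul, Complex.norm_exp_ofReal_mul_I, one_mul, hω]
        exact Real.norm_exp_I_mul_ofReal_sub_one_le
    _ = (eLpNorm (X - Y : Lp ℝ 2 P) 1 P).toReal := by
        rw [eLpNorm_one_eq_lintegral_enorm, integral_norm_eq_lintegral_enorm hXY.1]
    _ ≤ ‖X - Y‖ := by
        rw [Lp.norm_def]
        exact ENNReal.toReal_mono (Lp.eLpNorm_ne_top _)
          (eLpNorm_le_eLpNorm_of_exponent_le (by norm_num) (Lp.aestronglyMeasurable _))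

/-! ### The Wiener integral as a closed graph. -/

namespace IsWienerMeasure

variable {n : ℕ} {μ : Measure (WienerSpace n)}

/-- The pair formed by the integrand `1_{[0,t]} c` and its Wiener integral `w ↦ ⟨c, w t⟩`. -/
noncomputable def evalPair (hμ : IsWienerMeasure μ) (p : I × EuclideanSpace ℝ (Fin n)) :
    Lp (EuclideanSpace ℝ (Fin n)) 2 (volume : Measure I) × Lp ℝ 2 μ :=
  (indicatorConstLp 2 (measurableSet_Iic (a := p.1)) (measure_ne_top _ _) p.2,
    (hμ.memLp_inner_eval p.1 p.2).toLp)

/-- The graph of the Wiener integral: the closed span of the pairs `(1_{[0,t]} c, ⟨c, w t⟩)`. -/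
noncomputable def integralGraph (hμ : IsWienerMeasure μ) :
    Submodule ℝ (Lp (EuclideanSpace ℝ (Fin n)) 2 (volume : Measure I) × Lp ℝ 2 μ) :=
  (Submodule.span ℝ (Set.range hμ.evalPair)).topologicalClosure

lemma evalPair_mem_integralGraph (hμ : IsWienerMeasure μ) (p : I × EuclideanSpace ℝ (Fin n)) :
    hμ.evalPair p ∈ hμ.integralGraph :=
  Submodule.le_topologicalClosure _ (Submodule.subset_span ⟨p, rfl⟩)

lemma isClosed_integralGraph (hμ : IsWienerMeasure μ) :
    IsClosed (hμ.integralGraph : Set (Lp (EuclideanSpace ℝ (Fin n)) 2 (volume : Measure I)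
      × Lp ℝ 2 μ)) :=
  Submodule.isClosed_topologicalClosure _

/-- A closed property of the graph of the Wiener integral can be checked on the span. -/
lemma integralGraph_induction (hμ : IsWienerMeasure μ)
    {s : Set (Lp (EuclideanSpace ℝ (Fin n)) 2 (volume : Measure I) × Lp ℝ 2 μ)}
    (hs : IsClosed s) (h : ∀ p ∈ Submodule.span ℝ (Set.range hμ.evalPair), p ∈ s)
    {p : Lp (EuclideanSpace ℝ (Fin n)) 2 (volume : Measure I) × Lp ℝ 2 μ}
    (hp : p ∈ hμ.integralGraph) : p ∈ s :=
  closure_minimal h hs hp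

lemma volume_real_Iic (t : I) : (volume : Measure I).real (Set.Iic t) = t := by
  simp [measureReal_def, unitInterval.volume_Iic, t.2.1]

/-- The Brownian covariance min(s,t)⟨c,d⟩ is also the L² inner product of 1_{[0,s]}c and 1_{[0,t]}d.
This is the Itô isometry on generators. -/
lemma inner_evalPair (hμ : IsWienerMeasure μ) (p q : I × EuclideanSpace ℝ (Fin n)) :
    inner ℝ (hμ.evalPair p).1 (hμ.evalPair q).1 = inner ℝ (hμ.evalPair p).2 (hμ.evalPair q).2 := by
  trans (min p.1 q.1 : I) * inner ℝ p.2 q.2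
  · rw [L2.inner_def]
    have : ∀ᵐ s ∂(volume : Measure I), inner ℝ ((hμ.evalPair p).1 s) ((hμ.evalPair q).1 s) =
        (Set.Iic (min p.1 q.1)).indicator (fun _ => inner ℝ p.2 q.2) s := by
      filter_upwards [indicatorConstLp_coeFn (p := 2) (hs := measurableSet_Iic (a := p.1))
        (hμs := measure_ne_top (volume : Measure I) _) (c := p.2),
        indicatorConstLp_coeFn (p := 2) (hs := measurableSet_Iic (a := q.1))
        (hμs := measure_ne_top (volume : Measure I) _) (c := q.2)] with s h1 h2
      simp only [evalPair, h1, h2, Set.indicator_apply, Set.mem_Iic, le_min_iff]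
      split_ifs <;> simp_all
    rw [integral_congr_ae this, integral_indicator_const _ measurableSet_Iic, volume_real_Iic,
      smul_eq_mul]
  · rw [L2.inner_def, ← hμ.integral_inner_eval_mul_inner_eval]
    refine integral_congr_ae ?_
    filter_upwards [(hμ.memLp_inner_eval p.1 p.2).coeFn_toLp,
      (hμ.memLp_inner_eval q.1 q.2).coeFn_toLp] with w h1 h2
    simp [evalPair, h1, h2, mul_comm]

lemma inner_eq_of_mem_span (hμ : IsWienerMeasure μ)
    {p q : Lp (EuclideanSpace ℝ (Fin n)) 2 (volume : Measure I) × Lp ℝ 2 μ}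
    (hp : p ∈ Submodule.span ℝ (Set.range hμ.evalPair))
    (hq : q ∈ Submodule.span ℝ (Set.range hμ.evalPair)) :
    inner ℝ p.1 q.1 = inner ℝ p.2 q.2 := by
  induction hp, hq using Submodule.span_induction₂ with
  | mem_mem x y hx hy =>
    obtain ⟨p, rfl⟩ := hx
    obtain ⟨q, rfl⟩ := hy
    exact hμ.inner_evalPair p q
  | zero_left y hy => simp
  | zero_right x hx => simp
  | add_left x y z _ _ _ h1 h2 => simp [inner_add_left, h1, h2]
  | add_right x y z _ _ _ h1 h2 => simp [inner_add_right, h1, h2]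
  | smul_left r x y _ _ h => simp [real_inner_smul_left, h]
  | smul_right r x y _ _ h => simp [real_inner_smul_right, h]

lemma norm_eq_of_mem_span (hμ : IsWienerMeasure μ)
    {p : Lp (EuclideanSpace ℝ (Fin n)) 2 (volume : Measure I) × Lp ℝ 2 μ}
    (hp : p ∈ Submodule.span ℝ (Set.range hμ.evalPair)) : ‖p.1‖ = ‖p.2‖ := by
  rw [← sq_eq_sq₀ (norm_nonneg _) (norm_nonneg _), ← real_inner_self_eq_norm_sq,
    ← real_inner_self_eq_norm_sq, hμ.inner_eq_of_mem_span hp hp]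

/-- A finite linear combination of coordinates of a Gaussian process is Gaussian; the process is
reindexed by the pairs (t, c). -/
lemma hasGaussianLaw_of_mem_span (hμ : IsWienerMeasure μ)
    {p : Lp (EuclideanSpace ℝ (Fin n)) 2 (volume : Measure I) × Lp ℝ 2 μ}
    (hp : p ∈ Submodule.span ℝ (Set.range hμ.evalPair)) :
    HasGaussianLaw (fun w => p.2 w) μ ∧ ∫ w, p.2 w ∂μ = 0 := by
  obtain ⟨l, rfl⟩ := Finsupp.mem_span_range_iff_exists_finsupp.1 hp
  have hZ := (hμ.isGaussianProcess.comp_right (Prod.fst :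
    I × EuclideanSpace ℝ (Fin n) → I)).comp_left fun i => l i • innerSL ℝ i.2
  have hsum : (fun w => (l.sum fun i a => a • hμ.evalPair i).2 w) =ᵐ[μ]
      fun w => ∑ i ∈ l.support, l i * inner ℝ i.2 (w i.1) := by
    have h1 : (l.sum fun i a => a • hμ.evalPair i).2 =
        ∑ i ∈ l.support, ((hμ.memLp_inner_eval i.1 i.2).const_smul (l i)).toLp := by
      simp only [Finsupp.sum, Prod.snd_sum, Prod.smul_snd]
      rfl
    rw [h1]
    refine (Lp.coeFn_finsetSum _ _).trans ?_
    have h2 : ∀ᵐ w ∂μ, ∀ i ∈ l.support,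
        ((hμ.memLp_inner_eval i.1 i.2).const_smul (l i)).toLp _ w = l i * inner ℝ i.2 (w i.1) := by
      rw [Finset.eventually_all]
      intro i _
      filter_upwards [((hμ.memLp_inner_eval i.1 i.2).const_smul (l i)).coeFn_toLp] with w hw
      simpa using hw
    filter_upwards [h2] with w hw
    rw [Finset.sum_apply]
    exact Finset.sum_congr rfl hw
  constructor
  · refine HasGaussianLaw.congr ?_ hsum.symm
    exact hZ.hasGaussianLaw_fun_sum
  · have := hμ.isProbabilityMeasure
    rw [integral_congr_ae hsum, integral_finsetSum _ fun i _ =>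
      ((hμ.memLp_inner_eval i.1 i.2).integrable (by norm_num)).const_mul _]
    simp [integral_const_mul, hμ.integral_inner_eval]

lemma integral_cexp_of_mem_span (hμ : IsWienerMeasure μ)
    {p : Lp (EuclideanSpace ℝ (Fin n)) 2 (volume : Measure I) × Lp ℝ 2 μ}
    (hp : p ∈ Submodule.span ℝ (Set.range hμ.evalPair)) :
    ∫ w, Complex.exp (p.2 w * Complex.I) ∂μ = Complex.exp (-(‖p.1‖ ^ 2 / 2 : ℝ)) := by
  obtain ⟨hG, hm⟩ := hμ.hasGaussianLaw_of_mem_span hp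
  have := hμ.isProbabilityMeasure
  have h := hG.charFun_map_eq 1
  rw [charFun_apply_real, integral_map hG.aemeasurable (by fun_prop)] at h
  have hv : Var[fun w => p.2 w; μ] = ‖p.1‖ ^ 2 := by
    rw [hμ.norm_eq_of_mem_span hp, variance_of_integral_eq_zero hG.aemeasurable hm,
      ← real_inner_self_eq_norm_sq, L2.inner_def]
    simp [sq]
  simp only [Complex.ofReal_one, one_mul, RCLike.inner_apply, conj_trivial, mul_one] at h
  rw [h, hm, hv]
  congr 1
  push_cast
  ring

/-- The Wiener integral of `g` has characteristic function at one `exp (-‖g‖² / 2)`. -/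
lemma integral_cexp_of_mem_integralGraph (hμ : IsWienerMeasure μ)
    {p : Lp (EuclideanSpace ℝ (Fin n)) 2 (volume : Measure I) × Lp ℝ 2 μ}
    (hp : p ∈ hμ.integralGraph) :
    ∫ w, Complex.exp (p.2 w * Complex.I) ∂μ = Complex.exp (-(‖p.1‖ ^ 2 / 2 : ℝ)) := by
  have := hμ.isProbabilityMeasure
  exact hμ.integralGraph_induction
    (s := {p | ∫ w, Complex.exp (p.2 w * Complex.I) ∂μ = Complex.exp (-(‖p.1‖ ^ 2 / 2 : ℝ))})
    (isClosed_eq ((continuous_integral_cexp_Lp μ).comp continuous_snd) (by fun_prop))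
    (fun _ hp => hμ.integral_cexp_of_mem_span hp) hp

/-- The Wiener integral of `g` is a centered Gaussian variable with variance `‖g‖²`. -/
lemma hasLaw_of_mem_integralGraph (hμ : IsWienerMeasure μ)
    {p : Lp (EuclideanSpace ℝ (Fin n)) 2 (volume : Measure I) × Lp ℝ 2 μ}
    (hp : p ∈ hμ.integralGraph) :
    HasLaw (fun w => p.2 w) (gaussianReal 0 (‖p.1‖₊ ^ 2)) μ := by
  have := hμ.isProbabilityMeasure
  have hm : AEMeasurable (fun w => p.2 w) μ := (Lp.aestronglyMeasurable p.2).aemeasurable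
  have := Measure.isProbabilityMeasure_map hm
  refine ⟨hm, Measure.ext_of_charFun <| funext fun t => ?_⟩
  rw [charFun_gaussianReal, charFun_apply_real, integral_map hm (by fun_prop)]
  -- The characteristic function at t is the one at 1 of the integral of tg, so the value at 1
  -- suffices.
  have h := hμ.integral_cexp_of_mem_integralGraph (hμ.integralGraph.smul_mem t hp)
  have hc : ∫ w, Complex.exp ((t • p).2 w * Complex.I) ∂μ =
      ∫ w, Complex.exp (t * p.2 w * Complex.I) ∂μ := by
    refine integral_congr_ae ?_
    filter_upwards [Lp.coeFn_smul t p.2] with w hw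
    simp [hw]
  rw [← hc, h]
  congr 1
  simp [norm_smul, mul_pow]
  ring

end IsWienerMeasure

/-! ### Calculus of versions of Wiener integrals. -/

namespace IsWienerMeasure

variable {n : ℕ} {μ : Measure (WienerSpace n)}

/-- `X` is a version of the Wiener integral of `g`, in terms of the graph of the Wiener integral. -/
def IntegralPair (hμ : IsWienerMeasure μ) (g : I → EuclideanSpace ℝ (Fin n))
    (X : WienerSpace n → ℝ) : Prop :=
  ∃ p ∈ hμ.integralGraph, p.1 =ᵐ[volume] g ∧ p.2 =ᵐ[μ] X

namespace IntegralPair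

variable {hμ : IsWienerMeasure μ} {g h : I → EuclideanSpace ℝ (Fin n)} {X Y : WienerSpace n → ℝ}

lemma memLp_left (hX : hμ.IntegralPair g X) : MemLp g 2 volume := by
  obtain ⟨p, -, h1, -⟩ := hX
  exact (Lp.memLp p.1).ae_eq h1

lemma memLp_right (hX : hμ.IntegralPair g X) : MemLp X 2 μ := by
  obtain ⟨p, -, -, h2⟩ := hX
  exact (Lp.memLp p.2).ae_eq h2

lemma toLp_mem (hX : hμ.IntegralPair g X) :
    (hX.memLp_left.toLp, hX.memLp_right.toLp) ∈ hμ.integralGraph := by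
  obtain ⟨p, hp, h1, h2⟩ := id hX
  convert hp
  · exact Lp.ext ((MemLp.coeFn_toLp _).trans h1.symm)
  · exact Lp.ext ((MemLp.coeFn_toLp _).trans h2.symm)

lemma add (hX : hμ.IntegralPair g X) (hY : hμ.IntegralPair h Y) :
    hμ.IntegralPair (fun s => g s + h s) (fun w => X w + Y w) := by
  obtain ⟨p, hp, hp1, hp2⟩ := hX
  obtain ⟨q, hq, hq1, hq2⟩ := hY
  exact ⟨p + q, hμ.integralGraph.add_mem hp hq, (Lp.coeFn_add _ _).trans (hp1.add hq1),
    (Lp.coeFn_add _ _).trans (hp2.add hq2)⟩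

lemma const_smul (c : ℝ) (hX : hμ.IntegralPair g X) :
    hμ.IntegralPair (fun s => c • g s) (fun w => c * X w) := by
  obtain ⟨p, hp, hp1, hp2⟩ := hX
  exact ⟨c • p, hμ.integralGraph.smul_mem c hp, (Lp.coeFn_smul _ _).trans (hp1.const_smul c),
    (Lp.coeFn_smul _ _).trans (hp2.const_smul c)⟩

lemma sub (hX : hμ.IntegralPair g X) (hY : hμ.IntegralPair h Y) :
    hμ.IntegralPair (fun s => g s - h s) (fun w => X w - Y w) := by
  convert hX.add (hY.const_smul (-1)) using 2 <;> simp [sub_eq_add_neg]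

variable (hμ) in
lemma zero : hμ.IntegralPair (fun _ => 0) (fun _ => 0) :=
  ⟨0, hμ.integralGraph.zero_mem, Lp.coeFn_zero _ _ _, Lp.coeFn_zero _ _ _⟩

lemma sum {ι : Type*} (J : Finset ι) {g : ι → I → EuclideanSpace ℝ (Fin n)}
    {X : ι → WienerSpace n → ℝ} (hX : ∀ i ∈ J, hμ.IntegralPair (g i) (X i)) :
    hμ.IntegralPair (fun s => ∑ i ∈ J, g i s) (fun w => ∑ i ∈ J, X i w) := by
  classical
  induction J using Finset.induction_on with
  | empty => simpa using zero hμ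
  | insert i J hi ih =>
    simp only [Finset.sum_insert hi]
    exact (hX i (by simp)).add (ih fun j hj => hX j (by simp [hj]))

variable (hμ) in
lemma inner_eval (t : I) (c : EuclideanSpace ℝ (Fin n)) :
    hμ.IntegralPair ((Set.Iic t).indicator fun _ => c) (fun w => inner ℝ c (w t)) :=
  ⟨_, hμ.evalPair_mem_integralGraph (t, c),
    indicatorConstLp_coeFn (hs := measurableSet_Iic) (hμs := measure_ne_top _ _),
    (hμ.memLp_inner_eval t c).coeFn_toLp⟩

variable (hμ) in
-- For a ≤ b, the indicator of (a,b] is the difference of those of [0,b] and [0,a].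
lemma step {m : ℕ} {a b : Fin m → I} (hab : ∀ i, a i ≤ b i)
    (c : Fin m → EuclideanSpace ℝ (Fin n)) :
    hμ.IntegralPair (stepFunction a b c) (stepIntegral a b c) := by
  refine sum Finset.univ fun i _ => ?_
  convert (inner_eval hμ (b i) (c i)).sub (inner_eval hμ (a i) (c i)) using 2 with s w
  · have := hab i
    simp only [Set.indicator_apply, Set.mem_Ioc, Set.mem_Iic]
    split_ifs <;> grind
  · rw [inner_sub_right]

/-- The approximating step functions and their integrals lie in the graph and converge to (g, X),
and the graph is closed. -/
lemma of_isWienerIntegral (hg : MemLp g 2 volume) (hX : IsWienerIntegral μ g X) :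
    hμ.IntegralPair g X := by
  obtain ⟨hXm, hX⟩ := hX
  -- A single approximation, at distance less than 1, already puts X in L².
  have hXL : MemLp X 2 μ := by
    obtain ⟨m, a, b, c, hab, -, h⟩ := hX 1 one_pos
    have hS := (step hμ hab c).memLp_right
    have hd : MemLp (fun w => stepIntegral a b c w - X w) 2 μ :=
      ⟨hS.1.sub hXm, h.trans ENNReal.one_lt_top⟩
    convert hS.sub hd using 1
    ext w
    simp
  refine ⟨(hg.toLp, hXL.toLp), ?_, hg.coeFn_toLp, hXL.coeFn_toLp⟩
  rw [← SetLike.mem_coe, ← hμ.isClosed_integralGraph.closure_eq, EMetric.mem_closure_iff]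
  intro ε hε
  obtain ⟨m, a, b, c, hab, h1, h2⟩ := hX ε hε
  refine ⟨_, (step hμ hab c).toLp_mem, ?_⟩
  rw [edist_comm, Prod.edist_eq, Lp.edist_toLp_toLp, Lp.edist_toLp_toLp]
  exact max_lt h1 h2

lemma integral_cexp (hX : hμ.IntegralPair g X) :
    ∫ w, Complex.exp (X w * Complex.I) ∂μ =
      Complex.exp (-((eLpNorm g 2 volume).toReal ^ 2 / 2 : ℝ)) := by
  obtain ⟨p, hp, h1, h2⟩ := hX
  rw [← eLpNorm_congr_ae h1, ← Lp.norm_def, ← hμ.integral_cexp_of_mem_integralGraph hp]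
  refine integral_congr_ae ?_
  filter_upwards [h2] with w hw
  rw [hw]

end IntegralPair

end IsWienerMeasure

/-! ### Pointwise isometries on Lp and orthogonal matrices. -/

section FiberwiseIsometry

variable {α E : Type*} {mα : MeasurableSpace α} [NormedAddCommGroup E] [NormedSpace ℝ E]
  {ν : Measure α} {p : ℝ≥0∞}

lemma MeasureTheory.MemLp.linearIsometry_apply {A : α → E →ₗᵢ[ℝ] E}
    (hA : ∀ g : α → E, AEStronglyMeasurable g ν → AEStronglyMeasurable (fun s => A s (g s)) ν)
    {g : α → E} (hg : MemLp g p ν) : MemLp (fun s => A s (g s)) p ν :=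
  hg.congr_norm (hA g hg.1) (.of_forall fun s => by simp)

/-- The isometry of `Lp` given by a measurable family of isometries acting pointwise. -/
noncomputable def MeasureTheory.Lp.fiberwiseIsometry [Fact (1 ≤ p)] (A : α → E →ₗᵢ[ℝ] E)
    (hA : ∀ g : α → E, AEStronglyMeasurable g ν → AEStronglyMeasurable (fun s => A s (g s)) ν) :
    Lp E p ν →ₗᵢ[ℝ] Lp E p ν where
  toFun g := ((Lp.memLp g).linearIsometry_apply hA).toLp
  map_add' g h := by
    rw [← MemLp.toLp_add]
    refine MemLp.toLp_congr _ _ ?_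
    filter_upwards [Lp.coeFn_add g h] with s hs
    rw [hs, Pi.add_apply, map_add, Pi.add_apply]
  map_smul' c g := by
    rw [RingHom.id_apply, ← MemLp.toLp_const_smul]
    refine MemLp.toLp_congr _ _ ?_
    filter_upwards [Lp.coeFn_smul c g] with s hs
    rw [hs, Pi.smul_apply, map_smul, Pi.smul_apply]
  norm_map' g := by
    rw [Lp.norm_def g, LinearMap.coe_mk, AddHom.coe_mk, Lp.norm_toLp,
      eLpNorm_congr_norm_ae (.of_forall fun s => (A s).norm_map (g s))]

lemma MeasureTheory.Lp.coeFn_fiberwiseIsometry [Fact (1 ≤ p)] {A : α → E →ₗᵢ[ℝ] E}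
    (hA : ∀ g : α → E, AEStronglyMeasurable g ν → AEStronglyMeasurable (fun s => A s (g s)) ν)
    (g : Lp E p ν) : Lp.fiberwiseIsometry A hA g =ᵐ[ν] fun s => A s (g s) :=
  ((Lp.memLp g).linearIsometry_apply hA).coeFn_toLp

end FiberwiseIsometry

/-- The isometry of Euclidean space given by the transpose of an orthogonal matrix. -/
noncomputable def Matrix.transposeIsometry {n : ℕ} (Q : Matrix (Fin n) (Fin n) ℝ)
    (hQ : Q ∈ Matrix.orthogonalGroup (Fin n) ℝ) :
    EuclideanSpace ℝ (Fin n) →ₗᵢ[ℝ] EuclideanSpace ℝ (Fin n) where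
  toLinearMap := Matrix.toEuclideanLin Q.transpose
  norm_map' v := by
    rw [← sq_eq_sq₀ (norm_nonneg _) (norm_nonneg _), ← real_inner_self_eq_norm_sq,
      ← real_inner_self_eq_norm_sq]
    simp only [EuclideanSpace.inner_eq_star_dotProduct, star_trivial, Matrix.ofLp_toLpLin,
      Matrix.toLin'_apply]
    rw [Matrix.dotProduct_mulVec, Matrix.vecMul_transpose, Matrix.mulVec_mulVec,
      show Q * Q.transpose = 1 from (Matrix.mem_orthogonalGroup_iff _ _).1 hQ, Matrix.one_mulVec]

/-- Qᵀv is a combination of the rows of Q, and rows are the integrands that define T. -/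
lemma Matrix.transposeIsometry_apply {n : ℕ} (Q : Matrix (Fin n) (Fin n) ℝ)
    (hQ : Q ∈ Matrix.orthogonalGroup (Fin n) ℝ) (v : EuclideanSpace ℝ (Fin n)) :
    Matrix.transposeIsometry Q hQ v = ∑ i, v i • WithLp.toLp 2 (Q i) := by
  ext j
  simp [Matrix.transposeIsometry, Matrix.toLpLin_apply, Matrix.mulVec, dotProduct, mul_comm]

lemma aestronglyMeasurable_transposeIsometry {n : ℕ} {α : Type*} {mα : MeasurableSpace α}
    {ν : Measure α} {γ : α → Matrix (Fin n) (Fin n) ℝ}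
    (hγ_meas : ∀ i j, AEMeasurable (fun s => γ s i j) ν)
    (hγ_orth : ∀ s, γ s ∈ Matrix.orthogonalGroup (Fin n) ℝ) (g : α → EuclideanSpace ℝ (Fin n))
    (hg : AEStronglyMeasurable g ν) :
    AEStronglyMeasurable (fun s => (γ s).transposeIsometry (hγ_orth s) (g s)) ν := by
  simp only [Matrix.transposeIsometry_apply]
  refine Finset.aestronglyMeasurable_fun_sum _ fun i _ => ?_
  have hrow : AEMeasurable (fun s => γ s i) ν := aemeasurable_pi_iff.2 (hγ_meas i)
  have h1 : AEMeasurable (fun s => WithLp.toLp 2 (γ s i)) ν :=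
    (WithLp.measurable_toLp 2 _).comp_aemeasurable hrow
  have h2 : AEMeasurable (fun s => g s i) ν := by
    have := hg.aemeasurable
    fun_prop
  exact (h2.smul h1).aestronglyMeasurable

/-! ### Action of T on Wiener integrals and invariance of μ. -/

namespace IsWienerTransformation

open IsWienerMeasure

variable {n : ℕ} {μ : Measure (WienerSpace n)} {γ : I → Matrix (Fin n) (Fin n) ℝ}
  {T : WienerSpace n → WienerSpace n}

lemma memLp_row (hγ_meas : ∀ i j, AEMeasurable (fun s => γ s i j) (volume : Measure I))
    (hγ_orth : ∀ s, γ s ∈ Matrix.orthogonalGroup (Fin n) ℝ) (t : I) (i : Fin n) :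
    MemLp ((Set.Iic t).indicator fun s => WithLp.toLp 2 (γ s i)) 2 (volume : Measure I) := by
  have h := MemLp.linearIsometry_apply (p := 2)
    (aestronglyMeasurable_transposeIsometry hγ_meas hγ_orth)
    (memLp_const (EuclideanSpace.single i (1 : ℝ)))
  refine (h.indicator measurableSet_Iic (s := Set.Iic t)).ae_eq (.of_forall fun s => ?_)
  simp only [Set.indicator_apply]
  congr 1
  simp [Matrix.transposeIsometry_apply]

/-- Summing the defining integrals of the components of T with weights c i produces the integrand ∑
c i · (row i) = γᵀc on [0,t]. -/
lemma integralPair_inner_eval (hμ : IsWienerMeasure μ)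
    (hγ_meas : ∀ i j, AEMeasurable (fun s => γ s i j) (volume : Measure I))
    (hγ_orth : ∀ s, γ s ∈ Matrix.orthogonalGroup (Fin n) ℝ) (hT : IsWienerTransformation μ γ T)
    (t : I) (c : EuclideanSpace ℝ (Fin n)) :
    hμ.IntegralPair
      (fun s => (γ s).transposeIsometry (hγ_orth s) ((Set.Iic t).indicator (fun _ => c) s))
      (fun w => inner ℝ c (T w t)) := by
  convert IntegralPair.sum Finset.univ fun i _ =>
    (IntegralPair.of_isWienerIntegral (hμ := hμ) (memLp_row hγ_meas hγ_orth t i)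
      (hT.integral t i)).const_smul (c i) using 2 with s w
  · by_cases hs : s ∈ Set.Iic t
    · simp only [Set.indicator_of_mem hs, Matrix.transposeIsometry_apply]
    · simp [Set.indicator_of_notMem hs]
  · simp [PiLp.inner_apply, mul_comm]

/-- `T` preserves the Wiener measure. -/
lemma measurePreserving (hμ : IsWienerMeasure μ)
    (hγ_meas : ∀ i j, AEMeasurable (fun s => γ s i j) (volume : Measure I))
    (hγ_orth : ∀ s, γ s ∈ Matrix.orthogonalGroup (Fin n) ℝ) (hT : IsWienerTransformation μ γ T) :
    MeasurePreserving T μ μ := by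
  have := hμ.isProbabilityMeasure
  refine ⟨hT.measurable, WienerSpace.measure_ext_of_map_coe ?_⟩
  rw [Measure.map_map WienerSpace.measurable_coe hT.measurable]
  have hTm : Measurable fun (w : WienerSpace n) (t : I) => T w t :=
    WienerSpace.measurable_coe.comp hT.measurable
  -- Finite-dimensional laws determine the law of the process; they are compared through
  -- characteristic functions.
  refine (map_eq_iff_forall_finset_map_restrict_eq (X := fun t w => T w t)
    hTm.aemeasurable WienerSpace.measurable_coe.aemeasurable).2 fun J => ?_
  have h1 : Measurable fun w : WienerSpace n => J.restrict (fun t : I => T w t) :=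
    (Finset.measurable_restrict J).comp hTm
  have h2 : Measurable fun w : WienerSpace n => J.restrict (fun t : I => w t) :=
    (Finset.measurable_restrict J).comp WienerSpace.measurable_coe
  have := Measure.isProbabilityMeasure_map (μ := μ) h1.aemeasurable
  have := Measure.isProbabilityMeasure_map (μ := μ) h2.aemeasurable
  refine Measure.ext_of_charFunDual <| funext fun L => ?_
  rw [charFunDual_apply, charFunDual_apply, integral_map h1.aemeasurable (by fun_prop),
    integral_map h2.aemeasurable (by fun_prop)]
  classical
  set c : J → EuclideanSpace ℝ (Fin n) := fun t =>
    (InnerProductSpace.toDual ℝ _).symm (L ∘L .single ℝ (fun _ => EuclideanSpace ℝ (Fin n)) t) with hc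
  have hL (x : J → EuclideanSpace ℝ (Fin n)) : L x = ∑ t, inner ℝ (c t) (x t) := by
    simp [hc, -ContinuousLinearMap.comp_apply, ← L.sum_comp_single]
  have hW := IntegralPair.sum Finset.univ fun (t : J) _ => IntegralPair.inner_eval hμ t.1 (c t)
  have hTW := IntegralPair.sum Finset.univ fun (t : J) _ =>
    hT.integralPair_inner_eval hμ hγ_meas hγ_orth t.1 (c t)
  simp only [hL, Finset.restrict_def]
  -- By linearity γ(s)ᵀ comes out of the sum, so both integrands have the same norm at every s.
  have hnorm : eLpNorm (fun s => ∑ t : J, (γ s).transposeIsometry (hγ_orth s)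
      ((Set.Iic t.1).indicator (fun _ => c t) s)) 2 volume =
      eLpNorm (fun s => ∑ t : J, (Set.Iic t.1).indicator (fun _ => c t) s) 2 volume := by
    refine eLpNorm_congr_norm_ae (.of_forall fun s => ?_)
    rw [← map_sum, LinearIsometry.norm_map]
  rw [hW.integral_cexp, hTW.integral_cexp, hnorm]

/-- If `X` is the Wiener integral of `g`, then `X ∘ T` is the Wiener integral of `γᵀ g`. -/
lemma map_mem_integralGraph (hμ : IsWienerMeasure μ)
    (hγ_meas : ∀ i j, AEMeasurable (fun s => γ s i j) (volume : Measure I))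
    (hγ_orth : ∀ s, γ s ∈ Matrix.orthogonalGroup (Fin n) ℝ) (hT : IsWienerTransformation μ γ T)
    {p : Lp (EuclideanSpace ℝ (Fin n)) 2 (volume : Measure I) × Lp ℝ 2 μ}
    (hp : p ∈ hμ.integralGraph) :
    (Lp.fiberwiseIsometry _ (aestronglyMeasurable_transposeIsometry hγ_meas hγ_orth) p.1,
      Lp.compMeasurePreservingₗᵢ ℝ T (hT.measurePreserving hμ hγ_meas hγ_orth) p.2)
        ∈ hμ.integralGraph := by
  set M := Lp.fiberwiseIsometry (p := 2) _
    (aestronglyMeasurable_transposeIsometry (ν := (volume : Measure I)) hγ_meas hγ_orth) with hM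
  set U := Lp.compMeasurePreservingₗᵢ (E := ℝ) (p := 2) ℝ T
    (hT.measurePreserving hμ hγ_meas hγ_orth) with hU
  -- The condition is linear and closed, so only the generators (1_{[0,t]}c, ⟨c, w t⟩) need
  -- checking.
  refine hμ.integralGraph_induction (s := {p | (M p.1, U p.2) ∈ hμ.integralGraph})
    (hμ.isClosed_integralGraph.preimage (by fun_prop)) (fun p hp => ?_) hp
  induction hp using Submodule.span_induction with
  | mem p hp =>
    obtain ⟨⟨t, c⟩, rfl⟩ := hp
    obtain ⟨q, hq, h1, h2⟩ := hT.integralPair_inner_eval hμ hγ_meas hγ_orth t c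
    rw [Set.mem_ofPred_eq]
    convert hq
    · refine Lp.ext ((Lp.coeFn_fiberwiseIsometry _ _).trans (.trans ?_ h1.symm))
      filter_upwards [indicatorConstLp_coeFn (p := 2) (hs := measurableSet_Iic (a := t))
        (hμs := measure_ne_top (volume : Measure I) _) (c := c)] with s hs
      simp only [evalPair, hs]
    · refine Lp.ext ((Lp.coeFn_compMeasurePreserving _ _).trans (.trans ?_ h2.symm))
      exact (hT.measurePreserving hμ hγ_meas hγ_orth).quasiMeasurePreserving.ae_eq_comp
        (hμ.memLp_inner_eval t c).coeFn_toLp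
  | zero =>
    rw [Set.mem_ofPred_eq, Prod.fst_zero, Prod.snd_zero, map_zero, map_zero]
    exact hμ.integralGraph.zero_mem
  | add p q _ _ hp hq => simpa using! hμ.integralGraph.add_mem hp hq
  | smul r p _ hp => simpa using! hμ.integralGraph.smul_mem r hp

end IsWienerTransformation

/-! ### Real eigenvalues in odd dimension and ergodic averages. -/

/-- An orthogonal matrix `Q` of odd size has the eigenvalue `det Q`. -/
lemma Matrix.det_sub_smul_one_eq_zero_of_odd {n : ℕ} (hn : Odd n)
    {Q : Matrix (Fin n) (Fin n) ℝ} (hQ : Q ∈ Matrix.orthogonalGroup (Fin n) ℝ) :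
    (Q.det = 1 ∨ Q.det = -1) ∧ (Q - Q.det • (1 : Matrix (Fin n) (Fin n) ℝ)).det = 0 := by
  have hQQ : Q.transpose * Q = 1 := (Matrix.mem_orthogonalGroup_iff' _ _).1 hQ
  have hd : Q.det * Q.det = 1 := by
    simpa [Matrix.det_mul, Matrix.det_transpose] using congrArg Matrix.det hQQ
  refine ⟨mul_self_eq_one_iff.1 hd, ?_⟩
  -- With d = det Q and d² = 1, both sides are 1 - dQᵀ. For D = det(Q - d), determinants and odd n
  -- give dD = -dⁿD = -dD, so D = 0.
  have h1 : Q.transpose * (Q - Q.det • 1) = (-Q.det) • (Q - Q.det • 1).transpose := by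
    rw [Matrix.mul_sub, hQQ, Matrix.transpose_sub, smul_sub, Matrix.transpose_smul,
      Matrix.transpose_one, smul_smul, neg_mul, hd, Matrix.mul_smul, Matrix.mul_one]
    simp [sub_eq_add_neg, add_comm]
  have h2 := congrArg Matrix.det h1
  rw [Matrix.det_mul, Matrix.det_transpose, Matrix.det_smul, Matrix.det_transpose,
    Fintype.card_fin, hn.neg_pow] at h2
  have h3 : Q.det ^ n = Q.det := by
    obtain ⟨k, rfl⟩ := hn
    rw [pow_succ, pow_mul, sq, hd, one_pow, one_mul]
  rw [h3] at h2
  have h4 : Q.det * (Q - Q.det • (1 : Matrix (Fin n) (Fin n) ℝ)).det = 0 := by linarith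
  exact (mul_eq_zero.1 h4).resolve_left fun h => by simp [h] at hd

/-- The transpose of an orthogonal matrix of odd size has a real eigenvector, with
eigenvalue `1` or `-1`. -/
lemma Matrix.exists_smul_transposeIsometry_eq {n : ℕ} (hn : Odd n)
    {Q : Matrix (Fin n) (Fin n) ℝ} (hQ : Q ∈ Matrix.orthogonalGroup (Fin n) ℝ) :
    ∃ ε : ℝ, (ε = 1 ∨ ε = -1) ∧
      ∃ v : EuclideanSpace ℝ (Fin n), v ≠ 0 ∧ ε • Q.transposeIsometry hQ v = v := by
  obtain ⟨hε, hdet⟩ := Matrix.det_sub_smul_one_eq_zero_of_odd hn hQ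
  rw [← Matrix.det_transpose] at hdet
  obtain ⟨v, hv, hQv⟩ := Matrix.exists_mulVec_eq_zero_iff.2 hdet
  refine ⟨Q.det, hε, WithLp.toLp 2 v, by simpa using hv, ?_⟩
  rw [Matrix.transpose_sub, Matrix.transpose_smul, Matrix.transpose_one, Matrix.sub_mulVec,
    Matrix.smul_mulVec, Matrix.one_mulVec, sub_eq_zero] at hQv
  have h : Q.transposeIsometry hQ (WithLp.toLp 2 v) = Q.det • WithLp.toLp 2 v := by
    rw [← WithLp.toLp_smul, ← hQv]
    rfl
  rw [h, smul_smul]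
  rcases hε with hε | hε <;> simp [hε]

/-- Birkhoff averages of a map on `Lp` that acts pointwise are computed pointwise. -/
lemma birkhoffAverage_ae_eq {α E : Type*} {mα : MeasurableSpace α} [NormedAddCommGroup E]
    [NormedSpace ℝ E] {ν : Measure α} {p : ℝ≥0∞} {M : Lp E p ν → Lp E p ν} {B : α → E → E}
    (h : ∀ g, M g =ᵐ[ν] fun s => B s (g s)) (g : Lp E p ν) (N : ℕ) :
    (birkhoffAverage ℝ M id N g : Lp E p ν) =ᵐ[ν] fun s => birkhoffAverage ℝ (B s) id N (g s) := by
  have hiter (k : ℕ) : M^[k] g =ᵐ[ν] fun s => (B s)^[k] (g s) := by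
    induction k with
    | zero => exact .rfl
    | succ k ih =>
      filter_upwards [h (M^[k] g), ih] with s h1 h2
      rw [Function.iterate_succ_apply', Function.iterate_succ_apply', h1, h2]
  filter_upwards [Lp.coeFn_smul (N : ℝ)⁻¹ (∑ k ∈ Finset.range N, M^[k] g),
    Lp.coeFn_finsetSum (Finset.range N) fun k => M^[k] g, ae_all_iff.2 hiter] with s h1 h2 h3
  simp only [birkhoffAverage, birkhoffSum, id]
  rw [h1, Pi.smul_apply, h2, Finset.sum_apply, Finset.sum_congr rfl fun k _ => h3 k]

/-- If the Wiener integral of `g` has almost surely constant absolute value, then `g = 0`. -/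
lemma IsWienerMeasure.eq_zero_of_abs_ae_eq_const {n : ℕ} {μ : Measure (WienerSpace n)}
    (hμ : IsWienerMeasure μ)
    {p : Lp (EuclideanSpace ℝ (Fin n)) 2 (volume : Measure I) × Lp ℝ 2 μ}
    (hp : p ∈ hμ.integralGraph) {r : ℝ} (hr : ∀ᵐ w ∂μ, |p.2 w| = r) : p.1 = 0 := by
  by_contra h0
  have := hμ.isProbabilityMeasure
  have hlaw := hμ.hasLaw_of_mem_integralGraph hp
  -- A Gaussian of nonzero variance has no atoms, so it cannot be supported on {r, -r}.
  have hv : ‖p.1‖₊ ^ 2 ≠ 0 := pow_ne_zero _ (nnnorm_ne_zero_iff.2 h0)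
  have := nullSingletonClass_gaussianReal (μ := 0) hv
  have hnull : gaussianReal 0 (‖p.1‖₊ ^ 2) {r, -r} = 0 := (Set.toFinite _).measure_zero _
  rw [← hlaw.map_eq, Measure.map_apply_of_aemeasurable hlaw.aemeasurable
    (Set.toFinite _).measurableSet] at hnull
  have hfull : ∀ᵐ w ∂μ, w ∈ (fun w => p.2 w) ⁻¹' ({r, -r} : Set ℝ) := by
    filter_upwards [hr] with w hw
    exact eq_or_eq_neg_of_abs_eq hw
  have : (∀ᵐ w ∂μ, False) := by
    filter_upwards [hfull, measure_eq_zero_iff_ae_notMem.1 hnull] with w h1 h2 using h2 h1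
  simp at this
  exact IsProbabilityMeasure.ne_zero μ this

open Filter Topology in
/-- The mean ergodic theorem for a pair of contractions whose product preserves a closed
subspace. -/
lemma exists_tendsto_birkhoffAverage_mem {F G : Type*} [NormedAddCommGroup F]
    [InnerProductSpace ℝ F] [CompleteSpace F] [NormedAddCommGroup G] [InnerProductSpace ℝ G]
    [CompleteSpace G] {W : Submodule ℝ (F × G)} (hW : IsClosed (W : Set (F × G)))
    {M : F →L[ℝ] F} {U : G →L[ℝ] G} (hM : ‖M‖ ≤ 1) (hU : ‖U‖ ≤ 1)
    (h : ∀ q ∈ W, (M q.1, U q.2) ∈ W) {p : F × G} (hp : p ∈ W) :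
    ∃ q ∈ W, Tendsto (fun N => birkhoffAverage ℝ M id N p.1) atTop (𝓝 q.1) ∧ U q.2 = q.2 := by
  have hiter (k : ℕ) : (M^[k] p.1, U^[k] p.2) ∈ W := by
    induction k with
    | zero => exact hp
    | succ k ih =>
      rw [Function.iterate_succ_apply', Function.iterate_succ_apply']
      exact h _ ih
  have havg (N : ℕ) : (birkhoffAverage ℝ M id N p.1, birkhoffAverage ℝ U id N p.2) ∈ W := by
    convert W.smul_mem (N : ℝ)⁻¹
      (W.sum_mem (t := Finset.range N) fun k _ => hiter k) using 1
    ext1 <;> simp [birkhoffAverage, birkhoffSum, Prod.fst_sum, Prod.snd_sum]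
  -- Each coordinate converges to its projection onto the fixed space; closedness of W keeps the
  -- pair of limits in W.
  have hMlim := M.tendsto_birkhoffAverage_orthogonalProjection hM p.1
  have hUlim := U.tendsto_birkhoffAverage_orthogonalProjection hU p.2
  exact ⟨_, hW.mem_of_tendsto (hMlim.prodMk_nhds hUlim) (.of_forall havg), hMlim,
    ((U.eqLocus (1 : G →L[ℝ] G)).orthogonalProjectionOnto p.2).2⟩

/-! ### Failure of ergodicity. -/

namespace IsWienerTransformation

open IsWienerMeasure Filter Topology

variable {n : ℕ} {μ : Measure (WienerSpace n)} {γ : I → Matrix (Fin n) (Fin n) ℝ}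
  {T : WienerSpace n → WienerSpace n}

/-- If `T` is ergodic and `ε = ±1`, then the ergodic averages of a vector under `ε γ(s)ᵀ` tend to
`0` in `L²`, as their Wiener integrals tend to an invariant variable up to sign. -/
lemma tendsto_birkhoffAverage_zero_of_ergodic (hμ : IsWienerMeasure μ)
    (hγ_meas : ∀ i j, AEMeasurable (fun s => γ s i j) (volume : Measure I))
    (hγ_orth : ∀ s, γ s ∈ Matrix.orthogonalGroup (Fin n) ℝ) (hT : IsWienerTransformation μ γ T)
    (hE : Ergodic T μ) {ε : ℝ} (hε : ε = 1 ∨ ε = -1)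
    {p : Lp (EuclideanSpace ℝ (Fin n)) 2 (volume : Measure I) × Lp ℝ 2 μ}
    (hp : p ∈ hμ.integralGraph) :
    Tendsto (fun N => birkhoffAverage ℝ (fun g => ε • Lp.fiberwiseIsometry _
      (aestronglyMeasurable_transposeIsometry hγ_meas hγ_orth) g) id N p.1) atTop (𝓝 0) := by
  have hMP := hT.measurePreserving hμ hγ_meas hγ_orth
  have hε' : ‖ε‖ = 1 := by rcases hε with rfl | rfl <;> simp
  obtain ⟨q, hq, hlim, hfix⟩ := exists_tendsto_birkhoffAverage_mem hμ.isClosed_integralGraph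
    (M := ε • (Lp.fiberwiseIsometry (p := 2) _ (aestronglyMeasurable_transposeIsometry
      (ν := (volume : Measure I)) hγ_meas hγ_orth)).toContinuousLinearMap)
    (U := ε • (Lp.compMeasurePreservingₗᵢ (E := ℝ) (p := 2) ℝ T hMP).toContinuousLinearMap)
    (by
      rw [norm_smul, hε', one_mul]
      exact LinearIsometry.norm_toContinuousLinearMap_le _)
    (by
      rw [norm_smul, hε', one_mul]
      exact LinearIsometry.norm_toContinuousLinearMap_le _)
    (fun q hq => hμ.integralGraph.smul_mem ε (hT.map_mem_integralGraph hμ hγ_meas hγ_orth hq)) hp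
  -- The absolute value removes the sign in εX ∘ T = X, so both values of ε are treated alike.
  have hinv : (fun w => |q.2 w|) ∘ T =ᵐ[μ] fun w => |q.2 w| := by
    have h1 : (ε • Lp.compMeasurePreserving T hMP q.2 : Lp ℝ 2 μ) =ᵐ[μ]
        fun w => ε * q.2 (T w) :=
      (Lp.coeFn_smul ε _).trans ((Lp.coeFn_compMeasurePreserving q.2 hMP).fun_comp (ε * ·))
    replace hfix : (ε • Lp.compMeasurePreserving T hMP q.2 : Lp ℝ 2 μ) = q.2 := hfix
    rw [hfix] at h1
    filter_upwards [h1] with w hw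
    rw [hw, abs_mul, ← Real.norm_eq_abs ε, hε', one_mul, Function.comp_apply]
  obtain ⟨r, hr⟩ := hE.quasiErgodic.ae_eq_const_of_ae_eq_comp_ae
    (Lp.aestronglyMeasurable q.2).norm hinv
  rw [hμ.eq_zero_of_abs_ae_eq_const hq hr] at hlim
  exact hlim

lemma not_ergodic (hn : Odd n) (hμ : IsWienerMeasure μ)
    (hγ_meas : ∀ i j, AEMeasurable (fun s => γ s i j) (volume : Measure I))
    (hγ_orth : ∀ s, γ s ∈ Matrix.orthogonalGroup (Fin n) ℝ) (hT : IsWienerTransformation μ γ T) :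
    ¬ Ergodic T μ := by
  intro hE
  let B (ε : ℝ) (s : I) : EuclideanSpace ℝ (Fin n) →L[ℝ] EuclideanSpace ℝ (Fin n) :=
    ε • ((γ s).transposeIsometry (hγ_orth s)).toContinuousLinearMap
  have hB (ε : ℝ) (hε : ε = 1 ∨ ε = -1) (s : I) : ‖B ε s‖ ≤ 1 := by
    have hε' : ‖ε‖ = 1 := by rcases hε with rfl | rfl <;> simp
    rw [norm_smul, hε', one_mul]
    exact LinearIsometry.norm_toContinuousLinearMap_le _
  have hproj (ε : ℝ) (hε : ε = 1 ∨ ε = -1) (c : EuclideanSpace ℝ (Fin n)) :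
      ∀ᵐ s : I, ((B ε s).eqLocus 
        (1 : EuclideanSpace ℝ (Fin n) →L[ℝ] EuclideanSpace ℝ (Fin n))).orthogonalProjectionOnto c = 0 := by
    -- Time 1 makes the integrand the constant c on all of [0,1].
    have hlim := hT.tendsto_birkhoffAverage_zero_of_ergodic hμ hγ_meas hγ_orth hE hε
      (hμ.evalPair_mem_integralGraph (1, c))
    -- L² convergence gives almost everywhere convergence only along a subsequence, which is enough
    -- to identify the pointwise limit.
    obtain ⟨ns, hns, hae⟩ := (tendstoInMeasure_of_tendsto_Lp hlim).exists_seq_tendsto_ae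
    have hpt (N : ℕ) := birkhoffAverage_ae_eq (B := fun s => B ε s) (fun g =>
      (Lp.coeFn_smul ε _).trans ((Lp.coeFn_fiberwiseIsometry
        (aestronglyMeasurable_transposeIsometry hγ_meas hγ_orth) g).fun_comp (ε • ·)))
      (hμ.evalPair (1, c)).1 N
    filter_upwards [hae, ae_all_iff.2 hpt, Lp.coeFn_zero (EuclideanSpace ℝ (Fin n)) 2 volume,
      indicatorConstLp_coeFn (p := 2) (hs := measurableSet_Iic (a := (1 : I)))
        (hμs := measure_ne_top (volume : Measure I) _) (c := c)] with s h1 h2 h3 h4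
    have hc : (hμ.evalPair (1, c)).1 s = c := by
      simp only [evalPair, h4, Set.indicator_of_mem (show s ∈ Set.Iic (1 : I) from s.2.2)]
    simp only [h2, h3, hc] at h1
    have h5 := ((B ε s).tendsto_birkhoffAverage_orthogonalProjection (hB ε hε s) c).comp
      hns.tendsto_atTop
    exact Subtype.ext (tendsto_nhds_unique h5 h1)
  have hall : ∀ᵐ s : I, ∀ j : Fin n, ∀ ε : ℝ, (ε = 1 ∨ ε = -1) →
      ((B ε s).eqLocus 
        (1 : EuclideanSpace ℝ (Fin n) →L[ℝ] EuclideanSpace ℝ (Fin n))).orthogonalProjectionOnto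
        (EuclideanSpace.single j (1 : ℝ)) = 0 := by
    refine ae_all_iff.2 fun j => ?_
    filter_upwards [hproj 1 (.inl rfl) (EuclideanSpace.single j 1),
      hproj (-1) (.inr rfl) (EuclideanSpace.single j 1)] with s h1 h2
    rintro ε (rfl | rfl)
    exacts [h1, h2]
  obtain ⟨s, hs⟩ := hall.exists
  -- The sign ε depends on s. The fixed vector v is orthogonal to every basis vector, hence zero.
  obtain ⟨ε, hε, v, hv, hfix⟩ := Matrix.exists_smul_transposeIsometry_eq hn (hγ_orth s)
  refine hv (PiLp.ext fun j => ?_)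
  have hperp := (Submodule.orthogonalProjectionOnto_eq_zero_iff).1 (hs j ε hε)
  have h := hperp v hfix
  rwa [real_inner_comm, EuclideanSpace.inner_single_left, map_one, one_mul] at h

end IsWienerTransformation

theorem corollary4 (n : ℕ) (hn : Odd n)
    (μ : Measure (WienerSpace n)) (hμ : IsWienerMeasure μ)
    (γ : I → Matrix (Fin n) (Fin n) ℝ)
    (hγ_meas : ∀ i j, AEMeasurable (fun s => γ s i j) (volume : Measure I))
    (hγ_orth : ∀ s, γ s ∈ Matrix.orthogonalGroup (Fin n) ℝ)
    (T : WienerSpace n → WienerSpace n) (hT : IsWienerTransformation μ γ T) :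
    MeasurePreserving T μ μ ∧ ¬ Ergodic T μ :=
  ⟨hT.measurePreserving hμ hγ_meas hγ_orth, hT.not_ergodic hn hμ hγ_meas hγ_orth⟩
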